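/- Let $n\ge 1$, let $\Gamma\subset\mathbb R^n$ be a full-rank lattice (the image of $\mathbb Z^n$ under an invertible linear map), and let $A$ be an invertible real $n\times n$ matrix. An $(A,\Gamma)$ wavelet set is a Lebesgue measurable set $W\subset\mathbb R^n$ such that $$\sum_{j\in\mathbb Z}\mathbf 1_W(A^jx)=1\quad\text{and}\quad \sum_{\gamma\in\Gamma}\mathbf 1_W(x+\gamma)=1\qquad\text{for almost every }x\in\mathbb R^n .$$ For $r>0$ let $\mathbf B(0,r)$ be the open Euclidean ball of radius $r$ centered at $0$, and let $\#$ denote cardinality. (a) If $|\det A|>1$, then an $(A,\Gamma)$ wavelet set exists if and only if $$\sum_{j=1}^\infty\frac1{\#\bigl(A^{-j}(\mathbf B(0,1))\cap\Gamma\bigr)}=\infty .$$ (b) If $|\det A|>1$ and, for some $r>0$, $\displaystyle\sum_{j=1}^\infty\frac1{\#\bigl(A^{-j}(\mathbf B(0,r))\cap\Gamma\bigr)}=\infty$, then an $(A,\Gamma)$ wavelet set exists. (c) If $0<|\det A|<1$ and, for some $r>0$, $\displaystyle\sum_{j=1}^\infty\frac1{\#\bigl(A^{j}(\mathbf B(0,r))\cap\Gamma\bigr)}=\infty$,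 then an $(A,\Gamma)$ wavelet set exists. -/

import Mathlib

open MeasureTheory
open scoped ENNReal

/-- The dilation `x ↦ A ^ j x` of `ℝⁿ`, for an integer `j` (meaningful for negative `j` when `A` is
invertible). -/
noncomputable def dilation {n : ℕ} (A : Matrix (Fin n) (Fin n) ℝ) (j : ℤ) :
    EuclideanSpace ℝ (Fin n) →ₗ[ℝ] EuclideanSpace ℝ (Fin n) :=
  Matrix.toEuclideanLin (A ^ j)

/-- `U` packs by `A` dilations: `∑_{j ∈ ℤ} 1_U (A ^ j x) ≤ 1` for almost every `x`. -/
def PacksByDilations {n : ℕ} (A : Matrix (Fin n) (Fin n) ℝ)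
    (U : Set (EuclideanSpace ℝ (Fin n))) : Prop :=
  ∀ᵐ x, ∑' j : ℤ, U.indicator (fun _ => (1 : ℝ≥0∞)) (dilation A j x) ≤ 1

/-- `U` covers by `A` dilations: `∑_{j ∈ ℤ} 1_U (A ^ j x) ≥ 1` for almost every `x`. -/
def CoversByDilations {n : ℕ} (A : Matrix (Fin n) (Fin n) ℝ)
    (U : Set (EuclideanSpace ℝ (Fin n))) : Prop :=
  ∀ᵐ x, 1 ≤ ∑' j : ℤ, U.indicator (fun _ => (1 : ℝ≥0∞)) (dilation A j x)

/-- `V` packs by `Γ` translations: `∑_{γ ∈ Γ} 1_V (x + γ) ≤ 1` for almost every `x`. -/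
def PacksByTranslations {n : ℕ} (Γ : Submodule ℤ (EuclideanSpace ℝ (Fin n)))
    (V : Set (EuclideanSpace ℝ (Fin n))) : Prop :=
  ∀ᵐ x, ∑' γ : Γ, V.indicator (fun _ => (1 : ℝ≥0∞)) (x + γ) ≤ 1

/-- `V` covers by `Γ` translations: `∑_{γ ∈ Γ} 1_V (x + γ) ≥ 1` for almost every `x`. -/
def CoversByTranslations {n : ℕ} (Γ : Submodule ℤ (EuclideanSpace ℝ (Fin n)))
    (V : Set (EuclideanSpace ℝ (Fin n))) : Prop :=
  ∀ᵐ x, 1 ≤ ∑' γ : Γ, V.indicator (fun _ => (1 : ℝ≥0∞)) (x + γ)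

/-- An `(A, Γ)` wavelet set: a Lebesgue measurable set that tiles (packs and covers) `ℝⁿ` both by
`A` dilations and by `Γ` translations. -/
structure IsWaveletSet {n : ℕ} (A : Matrix (Fin n) (Fin n) ℝ)
    (Γ : Submodule ℤ (EuclideanSpace ℝ (Fin n)))
    (W : Set (EuclideanSpace ℝ (Fin n))) : Prop where
  measurable : NullMeasurableSet W
  packs_dilations : PacksByDilations A W
  covers_dilations : CoversByDilations A W
  packs_translations : PacksByTranslations Γ W
  covers_translations : CoversByTranslations Γ W

/-- The number of points of `Γ` in the ellipsoid `A ^ j (B(0, r))`. -/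
noncomputable def latticeCount {n : ℕ} (A : Matrix (Fin n) (Fin n) ℝ)
    (Γ : Submodule ℤ (EuclideanSpace ℝ (Fin n))) (j : ℤ) (r : ℝ) : ℕ∞ :=
  ((dilation A j '' Metric.ball 0 r) ∩ (Γ : Set (EuclideanSpace ℝ (Fin n)))).encard

/-! A wavelet set is a common tile of two countable actions. A measurable Cantor–Schröder–Bernstein
argument (`exists_common_tile`) reduces existence to finding V, which tiles by translations and
packs by dilations, and U, with the two roles exchanged. If |det A| > 1, V always exists: A has a
left eigenvector ℓ with eigenvalue |z| > 1, and a lattice cell moved far enough lies in a single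
annulus of |ℓ| of ratio |z|.

The series decides whether U exists. Let F be the part of a ball B(0,R) not yet covered by dilates.
The translates of A⁻ʲF overlap at most Nⱼ = #(A⁻ʲB(0,2R) ∩ Γ) times, so a transversal of A⁻ʲF has
volume at least |A⁻ʲF|/Nⱼ, and carried back by Aʲ it covers at least |F|/Nⱼ, up to what earlier
choices block. Running j downwards shrinks the blocked amount by 1/|det A| per step, so divergence
leaves arbitrarily little uncovered, while starting at large j keeps the volume used small
(`exists_packing_greedy`, `exists_small_packing_covering`). Such sets for growing balls are merged
by deleting from each the translates of all later, much smaller ones; thinning the union by a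
dilation transversal gives U.

Conversely, let W be a wavelet set. It has finite volume, and its packing bounds the part of B(0,R)
covered from scale j by a constant times |B(0,R)|/#(A⁻ʲB(0,1) ∩ Γ) (`latticeCount_mul_volume_le`).
Were the series convergent, its tail would cover less than half of the ball and the other scales a
volume bounded independently of R, which is absurd for large R. The case |det A| < 1 follows by
inverting A. -/

/-- The orbit of `x` under the family of maps `a` meets `S` at most once. -/
def HitsAtMostOnce {G X : Type*} (a : G → X → X) (S : Set X) (x : X) : Prop :=
  ∀ g h, a g x ∈ S → a h x ∈ S → g = h

/-- The points whose orbit under the family of maps `a` meets `S`. -/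
def saturation {G X : Type*} (a : G → X → X) (S : Set X) : Set X :=
  {x | ∃ g, a g x ∈ S}

/-! ### Transversals and common tiles for two countable actions -/

section Action

variable {G H X : Type*} {a : G → X → X} {b : H → X → X} {S T D : Set X} {x : X}

theorem HitsAtMostOnce.mono (h : HitsAtMostOnce a T x) (hST : S ⊆ T) : HitsAtMostOnce a S x :=
  fun g k hg hk => h g k (hST hg) (hST hk)

theorem saturation_mono (hST : S ⊆ T) : saturation a S ⊆ saturation a T :=
  fun _ ⟨g, hg⟩ => ⟨g, hST hg⟩

theorem MeasurableSet.saturation [Countable G] [MeasurableSpace X] (ha : ∀ g, Measurable (a g))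
    (hS : MeasurableSet S) : MeasurableSet (saturation a S) := by
  have : _root_.saturation a S = ⋃ g, a g ⁻¹' S := by
    ext x; simp [_root_.saturation]
  rw [this]
  exact MeasurableSet.iUnion fun g => ha g hS

theorem tsum_indicator_eq_encard :
    ∑' g, S.indicator (fun _ => (1 : ℝ≥0∞)) (a g x) = ({g | a g x ∈ S}.encard : ℝ≥0∞) := by
  rw [← ENNReal.tsum_set_one, tsum_subtype {g | a g x ∈ S} fun _ => (1 : ℝ≥0∞)]
  rfl

theorem tsum_indicator_le_one_iff :
    ∑' g, S.indicator (fun _ => (1 : ℝ≥0∞)) (a g x) ≤ 1 ↔ HitsAtMostOnce a S x := by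
  rw [tsum_indicator_eq_encard]
  have : (({g | a g x ∈ S}.encard : ℝ≥0∞) ≤ 1) ↔ {g | a g x ∈ S}.encard ≤ 1 := by
    rw [← ENat.toENNReal_one, ENat.toENNReal_le]
  rw [this, Set.encard_le_one_iff]
  rfl

theorem one_le_tsum_indicator_iff :
    1 ≤ ∑' g, S.indicator (fun _ => (1 : ℝ≥0∞)) (a g x) ↔ x ∈ saturation a S := by
  rw [tsum_indicator_eq_encard]
  have : (1 ≤ ({g | a g x ∈ S}.encard : ℝ≥0∞)) ↔ 1 ≤ {g | a g x ∈ S}.encard := by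
    rw [← ENat.toENNReal_one, ENat.toENNReal_le]
  rw [this, Set.one_le_encard_iff_nonempty]
  rfl

/-- A measurable set contains a measurable set which meets the same orbits, but each of them at most
once, wherever the action has a measurable fundamental domain. -/
theorem exists_transversal_subset [AddGroup G] [Countable G] [MeasurableSpace X]
    (ha : ∀ g h x, a (g + h) x = a g (a h x)) (hm : ∀ g, Measurable (a g))
    (hD : MeasurableSet D) (hS : MeasurableSet S) :
    ∃ S' ⊆ S, MeasurableSet S' ∧ ∀ x, x ∈ saturation a D → HitsAtMostOnce a D x →
      HitsAtMostOnce a S' x ∧ (x ∈ saturation a S → x ∈ saturation a S') := by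
  obtain ⟨e, he⟩ := exists_injective_nat G
  -- From the representative of the orbit in D, keep the point of S reached by the group element of
  -- least index in the enumeration `e`.
  refine ⟨{y ∈ S | ∃ g, a (-g) y ∈ D ∧ ∀ h, e h < e g → a h (a (-g) y) ∉ S},
    fun y hy => hy.1, ?_, ?_⟩
  · have : {y ∈ S | ∃ g, a (-g) y ∈ D ∧ ∀ h, e h < e g → a h (a (-g) y) ∉ S} =
        S ∩ ⋃ g, (a (-g) ⁻¹' D ∩ ⋂ h, ⋂ (_ : e h < e g), a (-g) ⁻¹' (a h ⁻¹' Sᶜ)) := by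
      ext y; simp
    rw [this]
    refine hS.inter (MeasurableSet.iUnion fun g => (hm _ hD).inter
      (MeasurableSet.iInter fun h => MeasurableSet.iInter fun _ => hm _ (hm _ hS.compl)))
  · rintro x ⟨k, hk⟩ hx
    constructor
    · rintro g₁ g₂ ⟨h₁, u, hu, hu'⟩ ⟨h₂, v, hv, hv'⟩
      rw [← ha] at hu hv
      have e₁ : -u + g₁ = k := hx _ _ hu hk
      have e₂ : -v + g₂ = k := hx _ _ hv hk
      rw [← ha, e₁] at hu'
      rw [← ha, e₂] at hv'
      have e₁' : g₁ = u + k := by rw [← e₁]; simp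
      have e₂' : g₂ = v + k := by rw [← e₂]; simp
      rw [e₁', ha] at h₁
      rw [e₂', ha] at h₂
      have huv : u = v := by
        apply he
        rcases lt_trichotomy (e u) (e v) with h | h | h
        · exact absurd h₁ (hv' u h)
        · exact h
        · exact absurd h₂ (hu' v h)
      rw [e₁', e₂', huv]
    · rintro ⟨g, hg⟩
      have hne : {n | ∃ g, e g = n ∧ a g (a k x) ∈ S}.Nonempty :=
        ⟨e (g + -k), g + -k, rfl, by rw [← ha]; simpa using hg⟩
      obtain ⟨u, hu, huS⟩ := Nat.sInf_mem hne
      refine ⟨u + k, by rw [ha]; exact huS, u, by rw [← ha]; simpa using hk, ?_⟩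
      intro h hh
      rw [← ha (-u), neg_add_cancel_left]
      intro hS'
      rw [hu] at hh
      exact Nat.notMem_of_lt_sInf hh ⟨h, rfl, hS'⟩

/-- A measurable Cantor–Schröder–Bernstein theorem for a pair of actions: from a set `U` which tiles
under `a` and packs under `b`, and a set `V` which packs under `a` and tiles under `b`, one obtains
a set which tiles under both. -/
theorem exists_common_tile [AddGroup G] [AddGroup H] [Countable G] [Countable H] [MeasurableSpace X]
    (ha : ∀ g h x, a (g + h) x = a g (a h x)) (hb : ∀ g h x, b (g + h) x = b g (b h x))
    (hma : ∀ g, Measurable (a g)) (hmb : ∀ g, Measurable (b g)) {U V : Set X}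
    (hU : MeasurableSet U) (hV : MeasurableSet V) :
    ∃ W, MeasurableSet W ∧
      (∀ x, HitsAtMostOnce a U x → x ∈ saturation a U → HitsAtMostOnce a V x →
        HitsAtMostOnce a W x ∧ x ∈ saturation a W) ∧
      (∀ x, HitsAtMostOnce b V x → x ∈ saturation b V → HitsAtMostOnce b U x →
        HitsAtMostOnce b W x ∧ x ∈ saturation b W) := by
  -- The Schröder–Bernstein operator. It is iterated countably often from ∅, rather than by
  -- Knaster–Tarski, so that the fixed point stays measurable.
  let Φ : Set X → Set X := fun S => U \ saturation a (V \ saturation b S)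
  have hΦmono : ∀ S T, S ⊆ T → Φ S ⊆ Φ T := fun S T h =>
    Set.sdiff_subset_sdiff_right (saturation_mono (Set.sdiff_subset_sdiff_right (saturation_mono h)))
  let s : ℕ → Set X := fun n => Φ^[n] ∅
  have hs : ∀ n, s (n + 1) = Φ (s n) := fun n => Function.iterate_succ_apply' _ _ _
  have hsm : ∀ n, MeasurableSet (s n) := by
    intro n
    induction n with
    | zero => exact MeasurableSet.empty
    | succ n ih =>
      rw [hs]
      exact hU.diff ((hV.diff (ih.saturation hmb)).saturation hma)
  have hstep : ∀ n, s n ⊆ s (n + 1) := by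
    intro n
    induction n with
    | zero => exact Set.empty_subset _
    | succ n ih => rw [hs, hs (n + 1)]; exact hΦmono _ _ ih
  have hmono : Monotone s := monotone_nat_of_le_succ hstep
  set U₂ : Set X := ⋃ n, s n with hU₂
  set V₁ : Set X := V \ saturation b U₂ with hV₁
  have hU₂m : MeasurableSet U₂ := MeasurableSet.iUnion hsm
  have hV₁V : V₁ ⊆ V := Set.sdiff_subset
  have hU₂U : U₂ ⊆ U := by
    refine Set.iUnion_subset fun n => ?_
    cases n with
    | zero => exact Set.empty_subset _
    | succ n => rw [hs]; exact Set.sdiff_subset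
  -- U₂ is a fixed point of Φ only where V packs: the orbit then has a single point in V, and if U₂
  -- reaches its `b`-orbit, this already happens at a finite stage.
  have hfix : ∀ y, HitsAtMostOnce a V y → (y ∈ U₂ ↔ y ∈ U ∧ y ∉ saturation a V₁) := by
    intro y hy
    constructor
    · intro h
      refine ⟨hU₂U h, ?_⟩
      obtain ⟨n, hn⟩ := Set.mem_iUnion.1 (hU₂ ▸ h)
      have hn' := hstep n hn
      rw [hs] at hn'
      intro h'
      exact hn'.2 (saturation_mono
        (Set.sdiff_subset_sdiff_right (saturation_mono (Set.subset_iUnion s n))) h')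
    · rintro ⟨hyU, hy'⟩
      by_cases h : ∃ g, a g y ∈ V
      · obtain ⟨g, hg⟩ := h
        have : a g y ∈ saturation b U₂ := by
          by_contra hc
          exact hy' ⟨g, hg, hc⟩
        obtain ⟨k, hk⟩ := this
        obtain ⟨n, hn⟩ := Set.mem_iUnion.1 (hU₂ ▸ hk)
        refine Set.mem_iUnion.2 ⟨n + 1, ?_⟩
        rw [hs]
        refine ⟨hyU, ?_⟩
        rintro ⟨g', hg', hg''⟩
        obtain rfl := hy _ _ hg hg'
        exact hg'' ⟨k, hn⟩
      · refine Set.mem_iUnion.2 ⟨1, ?_⟩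
        rw [hs]
        exact ⟨hyU, fun ⟨g, hg, _⟩ => h ⟨g, hg⟩⟩
  refine ⟨V₁ ∪ U₂, (hV.diff (hU₂m.saturation hmb)).union hU₂m, ?_, ?_⟩
  · rintro x hxU ⟨g, hg⟩ hxV
    have hVg : ∀ k, HitsAtMostOnce a V (a k x) := by
      intro k i j hi hj
      rw [← ha] at hi hj
      exact add_right_cancel (hxV _ _ hi hj)
    have hsat : ∀ k, a k x ∈ saturation a V₁ → x ∈ saturation a V₁ := by
      rintro k ⟨i, hi⟩
      exact ⟨i + k, by rwa [ha]⟩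
    have hsat' : ∀ k, x ∈ saturation a V₁ → a k x ∈ saturation a V₁ := by
      rintro k ⟨i, hi⟩
      exact ⟨i + -k, by rw [← ha]; simpa using hi⟩
    constructor
    · rintro i j (hi | hi) (hj | hj)
      · exact hxV _ _ (hV₁V hi) (hV₁V hj)
      · exact absurd (hsat' j ⟨i, hi⟩) ((hfix _ (hVg j)).1 hj).2
      · exact absurd (hsat' i ⟨j, hj⟩) ((hfix _ (hVg i)).1 hi).2
      · exact hxU _ _ (hU₂U hi) (hU₂U hj)
    · by_cases h : x ∈ saturation a V₁
      · exact saturation_mono Set.subset_union_left h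
      · exact ⟨g, Or.inr ((hfix _ (hVg g)).2 ⟨hg, fun h' => h (hsat g h')⟩)⟩
  · rintro x hxV ⟨g, hg⟩ hxU
    have hdisj : ∀ i j, b i x ∈ V₁ → b j x ∉ U₂ := fun i j hi hj =>
      hi.2 ⟨j + -i, by rw [← hb]; simpa using hj⟩
    constructor
    · rintro i j (hi | hi) (hj | hj)
      · exact hxV _ _ (hV₁V hi) (hV₁V hj)
      · exact absurd hj (hdisj i j hi)
      · exact absurd hi (hdisj j i hj)
      · exact hxU _ _ (hU₂U hi) (hU₂U hj)
    · by_cases h : b g x ∈ saturation b U₂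
      · obtain ⟨i, hi⟩ := h
        exact ⟨i + g, Or.inr (by rwa [hb])⟩
      · exact ⟨g, Or.inl ⟨hg, h⟩⟩

end Action

/-! ### Dilations and their expanding eigenfunctional -/

section Dilation

variable {n : ℕ} {A : Matrix (Fin n) (Fin n) ℝ}

theorem dilation_zero (x : EuclideanSpace ℝ (Fin n)) : dilation A 0 x = x := by
  simp [dilation]

theorem dilation_one (x : EuclideanSpace ℝ (Fin n)) :
    dilation A 1 x = Matrix.toEuclideanLin A x := by
  simp [dilation]

theorem dilation_add (hA : A.det ≠ 0) (i j : ℤ) (x : EuclideanSpace ℝ (Fin n)) :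
    dilation A (i + j) x = dilation A i (dilation A j x) := by
  simp [dilation, Matrix.toLpLin_apply, Matrix.zpow_add (isUnit_iff_ne_zero.2 hA)]

theorem dilation_neg_dilation (hA : A.det ≠ 0) (i : ℤ) (x : EuclideanSpace ℝ (Fin n)) :
    dilation A (-i) (dilation A i x) = x := by
  rw [← dilation_add hA, neg_add_cancel, dilation_zero]

theorem dilation_dilation_neg (hA : A.det ≠ 0) (i : ℤ) (x : EuclideanSpace ℝ (Fin n)) :
    dilation A i (dilation A (-i) x) = x := by
  rw [← dilation_add hA, add_neg_cancel, dilation_zero]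

theorem dilation_inv (hA : A.det ≠ 0) (j : ℤ) : dilation A⁻¹ j = dilation A (-j) := by
  simp only [dilation]
  rw [Matrix.inv_zpow' (isUnit_iff_ne_zero.2 hA)]

theorem measurable_dilation (j : ℤ) : Measurable (dilation A j) :=
  (LinearMap.continuous_of_finiteDimensional (dilation A j)).measurable

theorem det_dilation (j : ℤ) : LinearMap.det (dilation A j) = A.det ^ j := by
  rw [dilation, Matrix.toEuclideanLin_eq_toLin_orthonormal, LinearMap.det_toLin]
  cases j with
  | ofNat k => simp
  | negSucc k => simp [zpow_negSucc, Matrix.det_nonsing_inv]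

theorem volume_preimage_dilation (hA : A.det ≠ 0) (j : ℤ) (S : Set (EuclideanSpace ℝ (Fin n))) :
    volume (dilation A j ⁻¹' S) = ENNReal.ofReal (|A.det|⁻¹ ^ j) * volume S := by
  rw [Measure.addHaar_preimage_linearMap _ (by rw [det_dilation]; exact zpow_ne_zero _ hA),
    det_dilation, abs_inv, abs_zpow, inv_zpow]

theorem latticeCount_eq (hA : A.det ≠ 0) (Γ : Submodule ℤ (EuclideanSpace ℝ (Fin n))) (j : ℤ)
    (r : ℝ) : latticeCount A Γ j r =
      {γ : Γ | (γ : EuclideanSpace ℝ (Fin n)) ∈ dilation A (-j) ⁻¹' Metric.ball 0 r}.encard := by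
  rw [latticeCount, ← Subtype.val_injective.encard_image]
  congr 1
  ext x
  constructor
  · rintro ⟨⟨y, hy, rfl⟩, hx⟩
    exact ⟨⟨_, hx⟩, by simpa [dilation_neg_dilation hA] using hy, rfl⟩
  · rintro ⟨γ, hγ, rfl⟩
    exact ⟨⟨_, hγ, dilation_dilation_neg hA j _⟩, γ.2⟩

/-- A real matrix of determinant larger than one in absolute value has a left eigenvector, possibly
complex, whose eigenvalue lies outside of the closed unit disc. -/
theorem exists_eigenfunctional (hA : 1 < |A.det|) :
    ∃ (ℓ : EuclideanSpace ℝ (Fin n) →ₗ[ℝ] ℂ) (z : ℂ), ℓ ≠ 0 ∧ 1 < ‖z‖ ∧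
      ∀ x, ℓ (Matrix.toEuclideanLin A x) = z * ℓ x := by
  set B : Matrix (Fin n) (Fin n) ℂ := A.map Complex.ofReal with hB
  have hdet : B.det = (A.det : ℂ) := by
    rw [hB]; exact (RingHom.map_det Complex.ofRealHom A).symm
  -- The determinant is the product of the complex eigenvalues, so they cannot all lie in the closed
  -- unit disc.
  obtain ⟨z, hz, hz1⟩ : ∃ z ∈ B.charpoly.roots, 1 < ‖z‖ := by
    by_contra! h
    have h1 := Matrix.det_eq_prod_roots_charpoly_of_splits
      (IsAlgClosed.splits B.charpoly)
    have h2 : ‖B.charpoly.roots.prod‖ ≤ 1 := by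
      generalize B.charpoly.roots = s at h
      induction s using Multiset.induction with
      | empty => simp
      | cons w s ih =>
        rw [Multiset.prod_cons, norm_mul]
        exact mul_le_one₀ (h w (by simp)) (norm_nonneg _)
          (ih fun z hz => h z (Multiset.mem_cons_of_mem hz))
    rw [← h1, hdet, Complex.norm_real, Real.norm_eq_abs] at h2
    linarith
  have hroot : (Matrix.scalar (Fin n) z - B).det = 0 := by
    rw [← Matrix.eval_charpoly]
    exact (Polynomial.mem_roots'.1 hz).2
  obtain ⟨v, hv, hv0⟩ := Matrix.exists_vecMul_eq_zero_iff.2 hroot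
  have hvB : Matrix.vecMul v B = z • v := by
    rw [Matrix.vecMul_sub, sub_eq_zero] at hv0
    rw [← hv0]
    ext i
    simp [mul_comm]
  let ℓ : EuclideanSpace ℝ (Fin n) →ₗ[ℝ] ℂ :=
    { toFun := fun x => ∑ i, v i * (x i : ℂ)
      map_add' := fun x y => by simp [mul_add, Finset.sum_add_distrib]
      map_smul' := fun c x => by simp [Finset.mul_sum, mul_left_comm] }
  refine ⟨ℓ, z, ?_, hz1, fun x => ?_⟩
  · obtain ⟨i, hi⟩ := Function.ne_iff.1 hv
    intro h
    apply hi
    have : ℓ (EuclideanSpace.single i 1) = 0 := by rw [h]; rfl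
    simpa [ℓ, Pi.single_apply, apply_ite Complex.ofReal] using this
  · have h1 : ℓ (Matrix.toEuclideanLin A x) =
        v ⬝ᵥ Matrix.mulVec B (fun i => (x i : ℂ)) := by
      simp [ℓ, dotProduct, Matrix.toLpLin_apply, Matrix.mulVec, hB]
    rw [h1, Matrix.dotProduct_mulVec, hvB]
    simp [ℓ, dotProduct, Finset.mul_sum, mul_assoc]

theorem norm_eigenfunctional_dilation (hA : A.det ≠ 0)
    {ℓ : EuclideanSpace ℝ (Fin n) →ₗ[ℝ] ℂ} {z : ℂ}
    (hz : z ≠ 0) (hℓ : ∀ x, ℓ (Matrix.toEuclideanLin A x) = z * ℓ x) (j : ℤ)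
    (x : EuclideanSpace ℝ (Fin n)) : ‖ℓ (dilation A j x)‖ = ‖z‖ ^ j * ‖ℓ x‖ := by
  have key : ∀ j : ℤ, ℓ (dilation A j x) = z ^ j * ℓ x := by
    intro j
    induction j using Int.induction_on with
    | zero => simp [dilation_zero]
    | succ k ih =>
      rw [add_comm, dilation_add hA, dilation_one, hℓ, ih, zpow_add₀ hz, zpow_one, mul_assoc]
    | pred k ih =>
      have : dilation A (-(k : ℤ)) x = Matrix.toEuclideanLin A (dilation A (-(k : ℤ) - 1) x) := by
        rw [← dilation_one, ← dilation_add hA]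
        congr 2
        ring
      rw [this, hℓ] at ih
      rw [zpow_sub₀ hz, zpow_one, div_mul_eq_mul_div, ← ih, mul_div_cancel_left₀ _ hz]
  rw [key, norm_mul, norm_zpow]

/-- Each application of A multiplies ‖ℓ‖ by ‖z‖, exactly the ratio of the half-open annulus. -/
theorem hitsAtMostOnce_dilation_annulus (hA : A.det ≠ 0)
    {ℓ : EuclideanSpace ℝ (Fin n) →ₗ[ℝ] ℂ} {z : ℂ} (hz : 1 < ‖z‖)
    (hℓ : ∀ x, ℓ (Matrix.toEuclideanLin A x) = z * ℓ x) {R : ℝ} (hR : 0 < R)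
    (x : EuclideanSpace ℝ (Fin n)) :
    HitsAtMostOnce (fun j : ℤ => dilation A j) {y | ‖ℓ y‖ ∈ Set.Ico R (R * ‖z‖)} x := by
  have hz0 : z ≠ 0 := norm_pos_iff.1 (by linarith)
  have key : ∀ i j : ℤ, R ≤ ‖ℓ (dilation A i x)‖ → ‖ℓ (dilation A j x)‖ < R * ‖z‖ → j ≤ i := by
    intro i j hi hj
    rw [norm_eigenfunctional_dilation hA hz0 hℓ] at hi hj
    have hx : 0 < ‖ℓ x‖ := by
      by_contra h
      have : ‖ℓ x‖ = 0 := le_antisymm (not_lt.1 h) (norm_nonneg _)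
      rw [this] at hi
      linarith
    have h1 : ‖z‖ ^ j * ‖ℓ x‖ < ‖z‖ ^ (i + 1) * ‖ℓ x‖ := by
      rw [zpow_add_one₀ (by linarith)]
      nlinarith
    have := (zpow_lt_zpow_iff_right₀ hz).1 (lt_of_mul_lt_mul_right h1 hx.le)
    lia
  intro i j hi hj
  exact le_antisymm (key j i hj.1 hi.2) (key i j hi.1 hj.2)

/-- Dilations by a matrix of determinant larger than one in absolute value have a Borel fundamental
domain. -/
theorem exists_dilation_fundamentalDomain (hA : 1 < |A.det|) :
    ∃ D : Set (EuclideanSpace ℝ (Fin n)), MeasurableSet D ∧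
      (∀ x, HitsAtMostOnce (fun j : ℤ => dilation A j) D x) ∧
      ∀ᵐ x, x ∈ saturation (fun j : ℤ => dilation A j) D := by
  have hA0 : A.det ≠ 0 := abs_pos.1 (by linarith)
  obtain ⟨ℓ, z, hℓ0, hz, hℓ⟩ := exists_eigenfunctional hA
  have hc : Continuous ℓ := LinearMap.continuous_of_finiteDimensional ℓ
  refine ⟨{y | ‖ℓ y‖ ∈ Set.Ico 1 (1 * ‖z‖)}, hc.norm.measurable measurableSet_Ico,
    hitsAtMostOnce_dilation_annulus hA0 hz hℓ one_pos, ?_⟩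
  -- The annulus misses only the orbits inside the kernel of ℓ, a proper subspace.
  have hnull : volume (LinearMap.ker ℓ : Set (EuclideanSpace ℝ (Fin n))) = 0 :=
    Measure.addHaar_submodule _ _ fun h => hℓ0 (LinearMap.ker_eq_top.1 h)
  filter_upwards [measure_eq_zero_iff_ae_notMem.1 hnull] with x hx
  have hx' : 0 < ‖ℓ x‖ := norm_pos_iff.2 fun h => hx h
  obtain ⟨k, hk⟩ := exists_mem_Ico_zpow hx' hz
  have hzk : 0 < ‖z‖ ^ k := zpow_pos (by linarith) _
  refine ⟨-k, ?_⟩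
  rw [Set.mem_ofPred_eq, norm_eigenfunctional_dilation hA0 (norm_pos_iff.1 (by linarith)) hℓ,
    zpow_neg, inv_mul_eq_div]
  rw [zpow_add_one₀ (by linarith)] at hk
  exact ⟨(one_le_div hzk).2 hk.1, (div_lt_iff₀ hzk).2 (by linarith [hk.2])⟩

end Dilation

/-! ### Lattice translations and a tile that packs by dilations -/

section Lattice

variable {n : ℕ}

/-- Translation by the points of a lattice. -/
def latticeTranslate (Γ : Submodule ℤ (EuclideanSpace ℝ (Fin n))) (γ : Γ)
    (x : EuclideanSpace ℝ (Fin n)) : EuclideanSpace ℝ (Fin n) := x + γ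

variable (Γ : Submodule ℤ (EuclideanSpace ℝ (Fin n)))

theorem latticeTranslate_add (g h : Γ) (x : EuclideanSpace ℝ (Fin n)) :
    latticeTranslate Γ (g + h) x = latticeTranslate Γ g (latticeTranslate Γ h x) := by
  simp only [latticeTranslate, Submodule.coe_add]
  abel

theorem measurable_latticeTranslate (g : Γ) : Measurable (latticeTranslate Γ g) :=
  measurable_id.add_const _

theorem exists_lattice_fundamentalDomain [DiscreteTopology Γ] [IsZLattice ℝ Γ] :
    ∃ D : Set (EuclideanSpace ℝ (Fin n)), MeasurableSet D ∧ Bornology.IsBounded D ∧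
      ∀ x, HitsAtMostOnce (latticeTranslate Γ) D x ∧ x ∈ saturation (latticeTranslate Γ) D := by
  have hfree : Module.Free ℤ Γ := ZLattice.module_free ℝ Γ
  set b := (Module.Free.chooseBasis ℤ Γ).ofZLatticeBasis ℝ Γ with hb
  have hspan : Submodule.span ℤ (Set.range b) = Γ :=
    (Module.Free.chooseBasis ℤ Γ).ofZLatticeBasis_span ℝ Γ
  have hfin : Finite (Module.Free.ChooseBasisIndex ℤ Γ) := inferInstance
  refine ⟨ZSpan.fundamentalDomain b, ZSpan.fundamentalDomain_measurableSet b,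
    ZSpan.fundamentalDomain_isBounded b, fun x => ?_⟩
  obtain ⟨v, hv, huniq⟩ := ZSpan.exist_unique_vadd_mem_fundamentalDomain b x
  have hv' : (v : EuclideanSpace ℝ (Fin n)) + x ∈ ZSpan.fundamentalDomain b := hv
  constructor
  · have key : ∀ g : Γ, latticeTranslate Γ g x ∈ ZSpan.fundamentalDomain b →
        (g : EuclideanSpace ℝ (Fin n)) = v := by
      intro g hg
      have hg' : (g : EuclideanSpace ℝ (Fin n)) ∈ Submodule.span ℤ (Set.range b) := by
        rw [hspan]; exact g.2
      have := huniq ⟨g, hg'⟩ (by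
        change (g : EuclideanSpace ℝ (Fin n)) + x ∈ _
        rw [add_comm]; exact hg)
      exact congrArg Subtype.val this
    intro g h hg hh
    exact Subtype.ext ((key g hg).trans (key h hh).symm)
  · exact ⟨⟨v, hspan.le v.2⟩, by
      change x + (v : EuclideanSpace ℝ (Fin n)) ∈ _
      rw [add_comm]; exact hv'⟩

/-- For a matrix of determinant larger than one in absolute value, some translate of a fundamental
domain of the lattice packs by dilations. -/
theorem exists_tiles_translations_packs_dilations [DiscreteTopology Γ] [IsZLattice ℝ Γ]
    {A : Matrix (Fin n) (Fin n) ℝ} (hA : 1 < |A.det|) :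
    ∃ V : Set (EuclideanSpace ℝ (Fin n)), MeasurableSet V ∧
      (∀ x, HitsAtMostOnce (fun j : ℤ => dilation A j) V x) ∧
      ∀ x, HitsAtMostOnce (latticeTranslate Γ) V x ∧ x ∈ saturation (latticeTranslate Γ) V := by
  have hA0 : A.det ≠ 0 := abs_pos.1 (by linarith)
  obtain ⟨ℓ, z, hℓ0, hz, hℓ⟩ := exists_eigenfunctional hA
  have hc : Continuous ℓ := LinearMap.continuous_of_finiteDimensional ℓ
  obtain ⟨D, hDm, hDb, hD⟩ := exists_lattice_fundamentalDomain Γ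
  obtain ⟨C, hC⟩ : ∃ C, ∀ y ∈ D, ‖ℓ y‖ ≤ C := by
    obtain ⟨C, hC⟩ := ((hDb.isCompact_closure.image hc).isBounded).exists_norm_le
    exact ⟨C, fun y hy => hC _ ⟨y, subset_closure hy, rfl⟩⟩
  obtain ⟨p, hp⟩ : ∃ p, ℓ p ≠ 0 := by
    by_contra! h
    exact hℓ0 (LinearMap.ext h)
  have hp' : 0 < ‖ℓ p‖ := norm_pos_iff.2 hp
  -- With ‖ℓ‖ = t at the new centre, the moved cell has ‖ℓ‖ in [t - C, t + C]; t is large enough for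
  -- this to fit in one annulus of ratio ‖z‖.
  obtain ⟨t, ht0, ht1, ht2⟩ : ∃ t : ℝ, 0 < t ∧ 0 < t - C ∧ t + C < (t - C) * ‖z‖ := by
    have hz' : 0 < ‖z‖ - 1 := by linarith
    refine ⟨|C| + 1 + |C| * (‖z‖ + 1) / (‖z‖ - 1) , by positivity, ?_, ?_⟩
    · have : 0 ≤ |C| * (‖z‖ + 1) / (‖z‖ - 1) := by positivity
      linarith [le_abs_self C]
    · have h1 : |C| * (‖z‖ + 1) / (‖z‖ - 1) * (‖z‖ - 1) = |C| * (‖z‖ + 1) := by field_simp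
      have h2 : C * (‖z‖ + 1) ≤ |C| * (‖z‖ + 1) :=
        mul_le_mul_of_nonneg_right (le_abs_self C) (by linarith)
      nlinarith [abs_nonneg C]
  set y₀ := (t / ‖ℓ p‖) • p with hy₀
  have hy₀n : ‖ℓ y₀‖ = t := by
    rw [hy₀, map_smul, norm_smul, Real.norm_eq_abs, abs_of_pos (by positivity)]
    field_simp
  refine ⟨{x | x - y₀ ∈ D}, (measurable_id.sub_const y₀) hDm, fun x =>
    (hitsAtMostOnce_dilation_annulus hA0 hz hℓ ht1 x).mono fun y hy => ?_, fun x => ?_⟩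
  · have h1 : ‖ℓ (y - y₀)‖ ≤ C := hC _ hy
    have h2 : ℓ y = ℓ y₀ + ℓ (y - y₀) := by rw [← map_add, add_sub_cancel]
    constructor
    · have := norm_sub_le_norm_add (ℓ y₀) (ℓ (y - y₀))
      rw [h2]; linarith
    · have := norm_add_le (ℓ y₀) (ℓ (y - y₀))
      rw [h2]; linarith
  · have key : ∀ g : Γ, latticeTranslate Γ g x - y₀ = latticeTranslate Γ g (x - y₀) := fun g => by
      simp only [latticeTranslate]; abel
    constructor
    · intro g h hg hh
      rw [Set.mem_ofPred_eq, key] at hg hh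
      exact (hD (x - y₀)).1 g h hg hh
    · obtain ⟨g, hg⟩ := (hD (x - y₀)).2
      exact ⟨g, by rw [Set.mem_ofPred_eq, key]; exact hg⟩

end Lattice

/-! ### Volume comparison and lattice counts -/

section Counting

variable {n : ℕ} (Γ : Submodule ℤ (EuclideanSpace ℝ (Fin n)))
  {A : Matrix (Fin n) (Fin n) ℝ}

theorem volume_preimage_latticeTranslate (γ : Γ) (S : Set (EuclideanSpace ℝ (Fin n))) :
    volume (latticeTranslate Γ γ ⁻¹' S) = volume S :=
  measure_preimage_add_right volume (γ : EuclideanSpace ℝ (Fin n)) S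

/-- Mass transport: pieces of F are translated into U, where they overlap at most M times. With M =
1 it compares a packing set with a set meeting all of its orbits. -/
theorem volume_le_mul_of_subset_saturation [Countable Γ] {F U : Set (EuclideanSpace ℝ (Fin n))}
    (hF : MeasurableSet F) (hFU : F ⊆ saturation (latticeTranslate Γ) U)
    {M : ℝ≥0∞}
    (hM : ∀ᵐ x, ∑' γ, F.indicator (fun _ => (1 : ℝ≥0∞)) (latticeTranslate Γ γ x) ≤ M) :
    volume F ≤ M * volume U := by
  have hind : ∀ γ : Γ, Measurable
      fun x => F.indicator (fun _ => (1 : ℝ≥0∞)) (latticeTranslate Γ γ x) := fun γ =>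
    (measurable_const.indicator hF).comp (measurable_latticeTranslate Γ γ)
  have hpre : ∀ γ : Γ, volume (F ∩ latticeTranslate Γ γ ⁻¹' U) =
      ∫⁻ x in U, F.indicator (fun _ => (1 : ℝ≥0∞)) (latticeTranslate Γ (-γ) x) := by
    intro γ
    have h1 : F ∩ latticeTranslate Γ γ ⁻¹' U =
        latticeTranslate Γ γ ⁻¹' (latticeTranslate Γ (-γ) ⁻¹' F ∩ U) := by
      ext x
      simp [latticeTranslate]
    have h2 : (fun x => F.indicator (fun _ => (1 : ℝ≥0∞)) (latticeTranslate Γ (-γ) x)) =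
        (latticeTranslate Γ (-γ) ⁻¹' F).indicator 1 := rfl
    rw [h1, volume_preimage_latticeTranslate, h2,
      lintegral_indicator_one (measurable_latticeTranslate Γ _ hF),
      Measure.restrict_apply (measurable_latticeTranslate Γ _ hF)]
  calc volume F ≤ volume (⋃ γ, F ∩ latticeTranslate Γ γ ⁻¹' U) := by
        refine measure_mono fun x hx => ?_
        obtain ⟨γ, hγ⟩ := hFU hx
        exact Set.mem_iUnion.2 ⟨γ, hx, hγ⟩
    _ ≤ ∑' γ, volume (F ∩ latticeTranslate Γ γ ⁻¹' U) := measure_iUnion_le _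
    _ = ∑' γ : Γ, ∫⁻ x in U, F.indicator (fun _ => (1 : ℝ≥0∞)) (latticeTranslate Γ (-γ) x) :=
        tsum_congr hpre
    _ = ∑' γ : Γ, ∫⁻ x in U, F.indicator (fun _ => (1 : ℝ≥0∞)) (latticeTranslate Γ γ x) :=
        (Equiv.neg Γ).tsum_eq
          fun γ => ∫⁻ x in U, F.indicator (fun _ => (1 : ℝ≥0∞)) (latticeTranslate Γ γ x)
    _ = ∫⁻ x in U, ∑' γ : Γ, F.indicator (fun _ => (1 : ℝ≥0∞)) (latticeTranslate Γ γ x) :=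
        (lintegral_tsum fun γ => (hind γ).aemeasurable).symm
    _ ≤ ∫⁻ _ in U, M := lintegral_mono_ae (ae_restrict_of_ae hM)
    _ = M * volume U := by simp

/-- Two translates of x lying in F differ by a lattice point whose image under Aʲ has norm below 2R;
subtracting a fixed one injects them into the counted set. -/
theorem tsum_indicator_le_latticeCount (hA : A.det ≠ 0) {j : ℤ} {R : ℝ}
    {F : Set (EuclideanSpace ℝ (Fin n))} (hF : F ⊆ dilation A j ⁻¹' Metric.ball 0 R)
    (x : EuclideanSpace ℝ (Fin n)) :
    ∑' γ, F.indicator (fun _ => (1 : ℝ≥0∞)) (latticeTranslate Γ γ x) ≤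
      latticeCount A Γ (-j) (2 * R) := by
  rw [tsum_indicator_eq_encard, latticeCount_eq hA, neg_neg, ENat.toENNReal_le]
  rcases Set.eq_empty_or_nonempty {γ | latticeTranslate Γ γ x ∈ F} with h | ⟨γ₀, h₀⟩
  · rw [h]; simp
  · refine Set.encard_le_encard_of_injOn (f := fun γ => γ - γ₀) (fun γ hγ => ?_)
      fun _ _ _ _ h => sub_left_injective h
    have h1 : ‖dilation A j (latticeTranslate Γ γ x)‖ < R := by simpa using hF hγ
    have h2 : ‖dilation A j (latticeTranslate Γ γ₀ x)‖ < R := by simpa using hF h₀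
    have h3 : dilation A j ((γ - γ₀ : Γ) : EuclideanSpace ℝ (Fin n)) =
        dilation A j (latticeTranslate Γ γ x) - dilation A j (latticeTranslate Γ γ₀ x) := by
      rw [← map_sub]
      simp [latticeTranslate]
    change dilation A j ((γ - γ₀ : Γ) : EuclideanSpace ℝ (Fin n)) ∈ Metric.ball 0 (2 * R)
    rw [mem_ball_zero_iff, h3]
    linarith [norm_sub_le (dilation A j (latticeTranslate Γ γ x))
      (dilation A j (latticeTranslate Γ γ₀ x))]

theorem encard_biUnion_finset_le {α ι : Type*} (t : Finset ι) (S : ι → Set α) {N : ℕ∞}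
    (h : ∀ i ∈ t, (S i).encard ≤ N) : (⋃ i ∈ t, S i).encard ≤ t.card * N := by
  classical
  induction t using Finset.induction with
  | empty => simp
  | insert i t hi ih =>
    rw [Finset.set_biUnion_insert, Finset.card_insert_of_notMem hi, Nat.cast_add_one, add_mul,
      one_mul, add_comm]
    exact (Set.encard_union_le _ _).trans
      (add_le_add (h i (by simp)) (ih fun k hk => h k (by simp [hk])))

/-- Up to a constant factor, the lattice count does not depend on the radius. -/
theorem exists_latticeCount_le_mul (hA : A.det ≠ 0) (ρ : ℝ) {r : ℝ} (hr : 0 < r) :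
    ∃ c : ℕ, ∀ j, latticeCount A Γ j ρ ≤ c * latticeCount A Γ j r := by
  obtain ⟨t, -, ht⟩ := (isCompact_closedBall (0 : EuclideanSpace ℝ (Fin n)) ρ).elim_nhds_subcover
    (fun y => Metric.ball y (r / 2)) fun y _ => Metric.ball_mem_nhds y (by positivity)
  refine ⟨t.card, fun j => ?_⟩
  have hcov : {γ : Γ | (γ : EuclideanSpace ℝ (Fin n)) ∈ dilation A (-j) ⁻¹' Metric.ball 0 ρ} ⊆
      ⋃ y ∈ t, {γ : Γ | latticeTranslate Γ γ 0 ∈ dilation A (-j) ⁻¹' Metric.ball y (r / 2)} := by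
    intro γ hγ
    have := ht (Metric.ball_subset_closedBall hγ)
    simpa [latticeTranslate] using this
  rw [latticeCount_eq hA Γ j ρ]
  refine (Set.encard_le_encard hcov).trans (encard_biUnion_finset_le t _ fun y _ => ?_)
  -- Pulling the centre back to w turns the lattice points of one small ball into translates of -w
  -- landing in the centred ball of radius r/2.
  obtain ⟨w, rfl⟩ : ∃ w, dilation A (-j) w = y :=
    ⟨dilation A (- -j) y, dilation_dilation_neg hA _ _⟩
  have h := tsum_indicator_le_latticeCount Γ hA
    (Set.Subset.refl (dilation A (-j) ⁻¹' Metric.ball 0 (r / 2))) (-w)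
  rw [tsum_indicator_eq_encard, ENat.toENNReal_le, neg_neg, mul_div_cancel₀ r two_ne_zero] at h
  refine le_trans (Set.encard_le_encard fun γ hγ => ?_) h
  have hγ' : dist (dilation A (-j) (latticeTranslate Γ γ 0)) (dilation A (-j) w) < r / 2 := hγ
  rw [dist_eq_norm, ← map_sub] at hγ'
  change dilation A (-j) (latticeTranslate Γ γ (-w)) ∈ Metric.ball 0 (r / 2)
  have hw : latticeTranslate Γ γ (-w) = latticeTranslate Γ γ 0 - w := by
    simp only [latticeTranslate]
    abel
  rwa [mem_ball_zero_iff, hw]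

theorem one_le_latticeCount (hA : A.det ≠ 0) (j : ℤ) {r : ℝ} (hr : 0 < r) :
    1 ≤ latticeCount A Γ j r := by
  rw [latticeCount_eq hA, Set.one_le_encard_iff_nonempty]
  exact ⟨0, by simpa using hr⟩

theorem tsum_inv_latticeCount_eq_top (hA : A.det ≠ 0) {r : ℝ} (hr : 0 < r) (ρ : ℝ)
    (h : ∑' j : ℕ, (1 : ℝ≥0∞) / (latticeCount A Γ (-((j : ℤ) + 1)) r : ℝ≥0∞) = ∞) :
    ∑' j : ℕ, (latticeCount A Γ (-((j : ℤ) + 1)) ρ : ℝ≥0∞)⁻¹ = ∞ := by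
  obtain ⟨c, hc⟩ := exists_latticeCount_le_mul Γ hA ρ hr
  -- The factor c + 1 replaces c so that it is nonzero and can be inverted.
  have key : ∀ j, (1 : ℝ≥0∞) / (latticeCount A Γ j r : ℝ≥0∞) ≤
      ((c + 1 : ℕ) : ℝ≥0∞) * (latticeCount A Γ j ρ : ℝ≥0∞)⁻¹ := by
    intro j
    have h1 : (latticeCount A Γ j ρ : ℝ≥0∞) ≤ ((c + 1 : ℕ) : ℝ≥0∞) * latticeCount A Γ j r := by
      have h2 : latticeCount A Γ j ρ ≤ ((c + 1 : ℕ) : ℕ∞) * latticeCount A Γ j r :=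
        (hc j).trans (mul_le_mul_left (by exact_mod_cast Nat.le_succ c) _)
      have h3 := ENat.toENNReal_le.2 h2
      rwa [ENat.toENNReal_mul, ENat.toENNReal_coe] at h3
    calc (1 : ℝ≥0∞) / (latticeCount A Γ j r : ℝ≥0∞)
        = ((c + 1 : ℕ) : ℝ≥0∞) * (((c + 1 : ℕ) : ℝ≥0∞) * latticeCount A Γ j r)⁻¹ := by
          rw [ENNReal.mul_inv (Or.inl (by simp)) (Or.inl (by simp)), ← mul_assoc,
            ENNReal.mul_inv_cancel (by simp) (by simp), one_mul, one_div]
      _ ≤ _ := by gcongr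
  have h1 := ENNReal.tsum_le_tsum fun j : ℕ => key (-((j : ℤ) + 1))
  rw [h, ENNReal.tsum_mul_left, top_le_iff, ENNReal.mul_eq_top] at h1
  rcases h1 with h1 | h1
  · exact h1.2
  · exact absurd h1.1 (by simp)

end Counting

/-! ### Greedy packing and stability of coverage -/

theorem exists_lt_sum_range_add {g : ℕ → ℝ≥0∞} (hg : ∀ k, g k ≠ ∞) (h : ∑' k, g k = ∞) (J : ℕ)
    {C : ℝ≥0∞} (hC : C ≠ ∞) : ∃ l, C < ∑ k ∈ Finset.range l, g (J + k) := by
  have h1 : ∑' k, g (J + k) = ∞ := by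
    have := (ENNReal.summable (f := fun k => g (k + J))).sum_add_tsum_nat_add'
    rw [h, ENNReal.add_eq_top, ENNReal.sum_eq_top] at this
    simp_rw [add_comm J]
    exact this.resolve_left fun ⟨k, _, hk⟩ => hg k hk
  rw [ENNReal.tsum_eq_iSup_nat] at h1
  exact lt_iSup_iff.1 (h1 ▸ hC.lt_top)

section Packing

variable {n : ℕ} (Γ : Submodule ℤ (EuclideanSpace ℝ (Fin n))) [DiscreteTopology Γ]
  [IsZLattice ℝ Γ] {A : Matrix (Fin n) (Fin n) ℝ}

theorem measurableSet_saturation_dilation {n : ℕ} {A : Matrix (Fin n) (Fin n) ℝ}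
    {U : Set (EuclideanSpace ℝ (Fin n))}
    (hU : MeasurableSet U) : MeasurableSet (saturation (fun j : ℤ => dilation A j) U) :=
  hU.saturation (a := fun j : ℤ => dilation A j) fun j => measurable_dilation j

/-- A greedy construction, from the finest scale to the coarsest one, of a set which packs by
translations and whose dilates cover a large part of a ball. -/
theorem exists_packing_greedy (hA : A.det ≠ 0) (R : ℝ) {p : ℝ≥0∞}
    (hp : p + ENNReal.ofReal |A.det|⁻¹ = 1) (l : ℕ) : ∀ J : ℕ,
    ∃ U : Set (EuclideanSpace ℝ (Fin n)), MeasurableSet U ∧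
      (∀ x, HitsAtMostOnce (latticeTranslate Γ) U x) ∧
      p * volume (Metric.ball 0 R \ saturation (fun j : ℤ => dilation A j) U) *
          ∑ k ∈ Finset.range l, (latticeCount A Γ (-((J + k : ℕ) : ℤ)) (2 * R) : ℝ≥0∞)⁻¹ +
        ENNReal.ofReal |A.det|⁻¹ * (ENNReal.ofReal (|A.det| ^ J) * volume U) ≤
      volume (Metric.ball 0 R ∩ saturation (fun j : ℤ => dilation A j) U) := by
  set d := |A.det| with hd
  have hd0 : 0 < d := abs_pos.2 hA
  induction l with
  | zero =>
    exact fun J => ⟨∅, MeasurableSet.empty, fun x g h hg => hg.elim, by simp⟩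
  | succ l ih =>
    intro J
    obtain ⟨U, hUm, hUp, hU⟩ := ih (J + 1)
    set B : Set (EuclideanSpace ℝ (Fin n)) := Metric.ball 0 R with hB
    have hBm : MeasurableSet B := Metric.isOpen_ball.measurableSet
    set F := B \ saturation (fun j : ℤ => dilation A j) U with hF
    have hFm : MeasurableSet F := hBm.diff (measurableSet_saturation_dilation hUm)
    -- The uncovered part is pulled back to scale J; S will be a transversal of the portion of K
    -- that no translate of U reaches.
    set K := dilation A (J : ℤ) ⁻¹' F with hK
    have hKm : MeasurableSet K := measurable_dilation _ hFm
    have hTU := hUm.saturation (measurable_latticeTranslate Γ)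
    obtain ⟨D, hDm, -, hD⟩ := exists_lattice_fundamentalDomain Γ
    obtain ⟨S, hSK, hSm, hS⟩ := exists_transversal_subset (latticeTranslate_add Γ)
      (measurable_latticeTranslate Γ) hDm (hKm.diff hTU)
    have hS' := fun x => hS x (hD x).2 (hD x).1
    have hmono : saturation (fun j : ℤ => dilation A j) U ⊆
        saturation (fun j : ℤ => dilation A j) (U ∪ S) := saturation_mono Set.subset_union_left
    have hKsub : K ⊆ saturation (latticeTranslate Γ) (U ∪ S) := by
      intro x hx
      by_cases hxU : x ∈ saturation (latticeTranslate Γ) U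
      · exact saturation_mono Set.subset_union_left hxU
      · refine saturation_mono Set.subset_union_right ((hS' x).2 ⟨0, ?_⟩)
        have : latticeTranslate Γ 0 x = x := by simp [latticeTranslate]
        rw [this]
        exact ⟨hx, hxU⟩
    have hSU : ∀ x, ∀ g h, latticeTranslate Γ g x ∈ U → latticeTranslate Γ h x ∉ S :=
      fun x g h hg hh => (hSK hh).2 ⟨g - h, by
        rw [← latticeTranslate_add, sub_add_cancel]; exact hg⟩
    refine ⟨U ∪ S, hUm.union hSm, ?_, ?_⟩
    · rintro x g h (hg | hg) (hh | hh)
      · exact hUp x g h hg hh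
      · exact absurd hh (hSU x g h hg)
      · exact absurd hg (hSU x h g hh)
      · exact (hS' x).1 g h hg hh
    set N : ℝ≥0∞ := (latticeCount A Γ (-(J : ℤ)) (2 * R) : ℝ≥0∞) with hN
    set w := ENNReal.ofReal (d ^ J) * volume (U ∪ S) with hw
    have hdJ : ENNReal.ofReal (d ^ J) * ENNReal.ofReal (d⁻¹ ^ (J : ℤ)) = 1 := by
      rw [← ENNReal.ofReal_mul (by positivity), zpow_natCast, ← mul_pow,
        mul_inv_cancel₀ hd0.ne', one_pow, ENNReal.ofReal_one]
    -- Every orbit meeting K meets U ∪ S, and K overlaps its translates at most N times.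
    have hfw : volume F * N⁻¹ ≤ w := by
      have h1 := volume_le_mul_of_subset_saturation Γ hKm hKsub
        (Filter.Eventually.of_forall (tsum_indicator_le_latticeCount Γ hA (j := J) (R := R)
          (Set.preimage_mono Set.sdiff_subset)))
      rw [hK, volume_preimage_dilation hA, ← hd] at h1
      rw [← div_eq_mul_inv]
      refine ENNReal.div_le_of_le_mul ?_
      calc volume F = ENNReal.ofReal (d ^ J) *
            (ENNReal.ofReal (d⁻¹ ^ (J : ℤ)) * volume F) := by rw [← mul_assoc, hdJ, one_mul]
        _ ≤ ENNReal.ofReal (d ^ J) * (N * volume (U ∪ S)) := by gcongr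
        _ = w * N := by rw [hw]; ring
    set E := dilation A (-(J : ℤ)) ⁻¹' S with hE
    have hEvol : volume E = ENNReal.ofReal (d ^ J) * volume S := by
      rw [hE, volume_preimage_dilation hA, ← hd, zpow_neg, zpow_natCast, inv_pow, inv_inv]
    have hEF : E ⊆ F := by
      intro x hx
      have := (hSK hx).1
      rwa [hK, Set.mem_preimage, dilation_dilation_neg hA] at this
    -- The old volume term, stated at scale J + 1, loses a factor d at scale J; the remainder of w
    -- is newly covered by E.
    have hwle : w ≤ ENNReal.ofReal d⁻¹ * (ENNReal.ofReal (d ^ (J + 1)) * volume U) + volume E := by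
      have h1 : ENNReal.ofReal d⁻¹ * (ENNReal.ofReal (d ^ (J + 1)) * volume U) =
          ENNReal.ofReal (d ^ J) * volume U := by
        rw [← mul_assoc, ← ENNReal.ofReal_mul (by positivity)]
        congr 2
        field_simp
        ring
      rw [h1, hEvol, ← mul_add]
      exact mul_le_mul_right (measure_union_le _ _) _
    have hc : volume (B ∩ saturation (fun j : ℤ => dilation A j) U) + volume E ≤
        volume (B ∩ saturation (fun j : ℤ => dilation A j) (U ∪ S)) := by
      rw [← measure_union (Set.disjoint_left.2 fun x hx hxE => (hEF hxE).2 hx.2)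
        (measurable_dilation _ hSm)]
      refine measure_mono (Set.union_subset (Set.inter_subset_inter_right _ hmono) fun x hx =>
        ⟨(hEF hx).1, -(J : ℤ), Or.inr hx⟩)
    rw [Finset.sum_range_succ']
    set s := ∑ k ∈ Finset.range l,
      (latticeCount A Γ (-((J + (k + 1) : ℕ) : ℤ)) (2 * R) : ℝ≥0∞)⁻¹ with hs
    have hs' : ∑ k ∈ Finset.range l,
        (latticeCount A Γ (-((J + 1 + k : ℕ) : ℤ)) (2 * R) : ℝ≥0∞)⁻¹ = s := by
      refine Finset.sum_congr rfl fun k _ => ?_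
      rw [add_assoc, add_comm 1 k]
    rw [hs'] at hU
    rw [add_zero]
    -- Since p + d⁻¹ = 1, w splits: the share p pays for the new term N⁻¹ of the sum, the share d⁻¹
    -- is kept for the next scale.
    calc p * volume (B \ saturation (fun j : ℤ => dilation A j) (U ∪ S)) * (s + N⁻¹) +
          ENNReal.ofReal d⁻¹ * w
        ≤ p * volume F * (s + N⁻¹) + ENNReal.ofReal d⁻¹ * w := by
          have := Set.sdiff_subset_sdiff_right (s := B) hmono
          gcongr
      _ = p * volume F * s + (p * (volume F * N⁻¹) + ENNReal.ofReal d⁻¹ * w) := by ring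
      _ ≤ p * volume F * s + (p * w + ENNReal.ofReal d⁻¹ * w) := by gcongr
      _ = p * volume F * s + w := by rw [← add_mul, hp, one_mul]
      _ ≤ p * volume F * s +
          (ENNReal.ofReal d⁻¹ * (ENNReal.ofReal (d ^ (J + 1)) * volume U) + volume E) := by gcongr
      _ ≤ volume (B ∩ saturation (fun j : ℤ => dilation A j) U) + volume E := by
          rw [← add_assoc]; gcongr
      _ ≤ _ := hc

end Packing

/-- Coverage of a ball by the dilates of a set survives the removal of a small part of the set. -/
theorem exists_delta_volume_diff_saturation_le {n : ℕ} {A : Matrix (Fin n) (Fin n) ℝ}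
    (hA : A.det ≠ 0)
    {U : Set (EuclideanSpace ℝ (Fin n))} (hU : MeasurableSet U) {R : ℝ} {ε ε' : ℝ≥0∞}
    (hε : volume (Metric.ball 0 R \ saturation (fun j : ℤ => dilation A j) U) ≤ ε) (hεε' : ε < ε') :
    ∃ δ : ℝ≥0∞, δ ≠ 0 ∧ ∀ Z, volume (U ∩ Z) ≤ δ →
      volume (Metric.ball 0 R \ saturation (fun j : ℤ => dilation A j) (U \ Z)) ≤ ε' := by
  -- Finitely many dilations already cover nearly as much, and these enlarge the volume of a removed
  -- piece by a finite total factor c.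
  let C : ℕ → Set (EuclideanSpace ℝ (Fin n)) := fun I =>
    Metric.ball 0 R \ ⋃ i ∈ Finset.Icc (-(I : ℤ)) I, dilation A i ⁻¹' U
  have hCm : ∀ I, MeasurableSet (C I) := fun I => Metric.isOpen_ball.measurableSet.diff
    (Finset.measurableSet_biUnion _ fun i _ => measurable_dilation i hU)
  have hCanti : Antitone C := by
    intro I I' h
    refine Set.sdiff_subset_sdiff_right (Set.biUnion_subset_biUnion_left fun i hi => ?_)
    simp only [Finset.coe_Icc, Set.mem_Icc] at hi ⊢
    lia
  have hCinter : ⋂ I, C I = Metric.ball 0 R \ saturation (fun j : ℤ => dilation A j) U := by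
    ext x
    simp only [C, Set.mem_iInter, Set.mem_sdiff, Set.mem_iUnion, Finset.mem_Icc, saturation,
      Set.mem_ofPred_eq, Set.mem_preimage, not_exists]
    constructor
    · intro h
      refine ⟨(h 0).1, fun i => (h i.natAbs).2 i (by lia)⟩
    · exact fun h I => ⟨h.1, fun i _ => h.2 i⟩
  have htend := tendsto_measure_iInter_atTop (μ := volume)
    (fun I => (hCm I).nullMeasurableSet) hCanti
    ⟨0, ((measure_mono Set.sdiff_subset).trans_lt measure_ball_lt_top).ne⟩
  rw [hCinter] at htend
  obtain ⟨I, hI⟩ := (htend.eventually_lt_const (hε.trans_lt hεε')).exists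
  set c : ℝ≥0∞ := ∑ i ∈ Finset.Icc (-(I : ℤ)) I, ENNReal.ofReal (|A.det|⁻¹ ^ i) with hc
  have hct : c ≠ ∞ := ENNReal.sum_ne_top.2 fun i _ => ENNReal.ofReal_ne_top
  refine ⟨(ε' - volume (C I)) / c, ENNReal.div_ne_zero.2 ⟨(tsub_pos_of_lt hI).ne', hct⟩,
    fun Z hZ => ?_⟩
  calc volume (Metric.ball 0 R \ saturation (fun j : ℤ => dilation A j) (U \ Z))
      ≤ volume (C I ∪ ⋃ i ∈ Finset.Icc (-(I : ℤ)) I, dilation A i ⁻¹' (U ∩ Z)) := by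
        refine measure_mono fun x hx => ?_
        by_cases h : x ∈ ⋃ i ∈ Finset.Icc (-(I : ℤ)) I, dilation A i ⁻¹' U
        · simp only [Set.mem_iUnion] at h
          obtain ⟨i, hi, hxi⟩ := h
          refine Or.inr (Set.mem_biUnion hi ⟨hxi, ?_⟩)
          by_contra hz
          exact hx.2 ⟨i, hxi, hz⟩
        · exact Or.inl ⟨hx.1, h⟩
    _ ≤ volume (C I) + ∑ i ∈ Finset.Icc (-(I : ℤ)) I, volume (dilation A i ⁻¹' (U ∩ Z)) :=
        (measure_union_le _ _).trans
          (add_le_add_right (measure_biUnion_finset_le _ _) _)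
    _ = volume (C I) + c * volume (U ∩ Z) := by
        rw [hc, Finset.sum_mul]
        congr 1
        exact Finset.sum_congr rfl fun i _ => volume_preimage_dilation hA i _
    _ ≤ volume (C I) + c * ((ε' - volume (C I)) / c) := by gcongr
    _ ≤ volume (C I) + (ε' - volume (C I)) := by gcongr; exact ENNReal.mul_div_le
    _ = ε' := add_tsub_cancel_of_le hI.le

/-! ### Existence of wavelet sets from divergence -/

section Existence

variable {n : ℕ} (Γ : Submodule ℤ (EuclideanSpace ℝ (Fin n))) [DiscreteTopology Γ]
  [IsZLattice ℝ Γ] {A : Matrix (Fin n) (Fin n) ℝ}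

/-- Both terms on the left of the greedy inequality are at most the volume of the ball: a high
starting scale makes U small, and a large partial sum makes the uncovered part small. -/
theorem exists_small_packing_covering (hA : 1 < |A.det|)
    (hdiv : ∀ ρ : ℝ, ∑' j : ℕ, (latticeCount A Γ (-((j : ℤ) + 1)) ρ : ℝ≥0∞)⁻¹ = ∞)
    {R : ℝ} (hR : 0 < R) {ε : ℝ≥0∞} (hε : ε ≠ 0) :
    ∃ U : Set (EuclideanSpace ℝ (Fin n)), MeasurableSet U ∧
      (∀ x, HitsAtMostOnce (latticeTranslate Γ) U x) ∧ volume U ≤ ε ∧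
      volume (Metric.ball 0 R \ saturation (fun j : ℤ => dilation A j) U) ≤ ε := by
  have hA0 : A.det ≠ 0 := abs_pos.1 (by linarith)
  wlog hεt : ε ≠ ∞ generalizing ε
  · obtain ⟨U, h1, h2, -, -⟩ := this one_ne_zero ENNReal.one_ne_top
    rw [not_ne_iff.1 hεt]
    exact ⟨U, h1, h2, le_top, le_top⟩
  set d := |A.det| with hd
  have hd0 : 0 < d := by linarith
  set q := ENNReal.ofReal d⁻¹ with hq
  have hq1 : q < 1 := by
    rw [hq, ENNReal.ofReal_lt_one]
    exact inv_lt_one_of_one_lt₀ hA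
  have hq0 : q ≠ 0 := by
    rw [hq, Ne, ENNReal.ofReal_eq_zero, not_le]
    positivity
  set B : ℝ≥0∞ := volume (Metric.ball (0 : EuclideanSpace ℝ (Fin n)) R) with hB
  have hBt : B ≠ ∞ := measure_ball_lt_top.ne
  have hp0 : 1 - q ≠ 0 := (tsub_pos_of_lt hq1).ne'
  have hpt : 1 - q ≠ ∞ := ENNReal.sub_ne_top ENNReal.one_ne_top
  have hg : ∀ k : ℕ, (latticeCount A Γ (-((k : ℤ) + 1)) (2 * R) : ℝ≥0∞)⁻¹ ≠ ∞ := fun k => by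
    have h1 := ENat.toENNReal_le.2 (one_le_latticeCount Γ hA0 (-((k : ℤ) + 1))
      (r := 2 * R) (by linarith))
    rw [ENNReal.inv_ne_top]
    rw [ENat.toENNReal_one] at h1
    exact (zero_lt_one.trans_le h1).ne'
  obtain ⟨J, hJ⟩ : ∃ J : ℕ, B ≤ q * ENNReal.ofReal (d ^ (J + 1)) * ε := by
    obtain ⟨J, hJ⟩ := pow_unbounded_of_one_lt (B / ε).toReal hA
    refine ⟨J, ?_⟩
    have h1 : q * ENNReal.ofReal (d ^ (J + 1)) = ENNReal.ofReal (d ^ J) := by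
      rw [hq, ← ENNReal.ofReal_mul (by positivity)]
      congr 1
      field_simp
      ring
    rw [h1, ← ENNReal.div_le_iff hε hεt]
    exact (ENNReal.le_ofReal_iff_toReal_le (ENNReal.div_ne_top hBt hε) (by positivity)).2 hJ.le
  obtain ⟨l, hl⟩ := exists_lt_sum_range_add hg (hdiv (2 * R)) J
    (C := B / ((1 - q) * ε)) (ENNReal.div_ne_top hBt (mul_ne_zero hp0 hε))
  obtain ⟨U, hUm, hUp, hU⟩ := exists_packing_greedy Γ hA0 R
    (tsub_add_cancel_of_le hq1.le) l (J + 1)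
  refine ⟨U, hUm, hUp, ?_, ?_⟩
  · have h1 : q * ENNReal.ofReal (d ^ (J + 1)) * volume U ≤
        q * ENNReal.ofReal (d ^ (J + 1)) * ε := by
      rw [mul_assoc]
      exact ((le_add_self.trans hU).trans (measure_mono Set.inter_subset_left)).trans hJ
    refine (ENNReal.mul_le_mul_iff_right ?_ ?_).1 h1
    · refine mul_ne_zero hq0 ?_
      rw [Ne, ENNReal.ofReal_eq_zero, not_le]
      positivity
    · exact ENNReal.mul_ne_top ENNReal.ofReal_ne_top ENNReal.ofReal_ne_top
  · by_contra! hlt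
    have h1 := (le_self_add.trans hU).trans (measure_mono Set.inter_subset_left)
    have h2 : ∑ k ∈ Finset.range l, (latticeCount A Γ (-((J + 1 + k : ℕ) : ℤ)) (2 * R) : ℝ≥0∞)⁻¹ =
        ∑ k ∈ Finset.range l, (latticeCount A Γ (-(((J + k : ℕ) : ℤ) + 1)) (2 * R) : ℝ≥0∞)⁻¹ := by
      refine Finset.sum_congr rfl fun k _ => ?_
      congr 4
      push_cast
      ring
    rw [h2] at h1
    have h3 : B < (1 - q) * ε * ∑ k ∈ Finset.range l,
        (latticeCount A Γ (-(((J + k : ℕ) : ℤ) + 1)) (2 * R) : ℝ≥0∞)⁻¹ := by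
      rw [mul_comm]
      exact (ENNReal.div_lt_iff (Or.inl (mul_ne_zero hp0 hε))
        (Or.inl (ENNReal.mul_ne_top hpt hεt))).1 hl
    refine absurd (h3.trans_le (le_trans ?_ h1)) (lt_irrefl _)
    gcongr

/-- Divergence of the series of inverse lattice counts gives a set which packs by translations and
covers by dilations. -/
theorem exists_packs_translations_covers_dilations (hA : 1 < |A.det|)
    (hdiv : ∀ ρ : ℝ, ∑' j : ℕ, (latticeCount A Γ (-((j : ℤ) + 1)) ρ : ℝ≥0∞)⁻¹ = ∞) :
    ∃ U : Set (EuclideanSpace ℝ (Fin n)), MeasurableSet U ∧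
      (∀ x, HitsAtMostOnce (latticeTranslate Γ) U x) ∧
      ∀ᵐ x, x ∈ saturation (fun j : ℤ => dilation A j) U := by
  have hA0 : A.det ≠ 0 := abs_pos.1 (by linarith)
  have hstep : ∀ (s : ℕ) (δ : {δ : ℝ≥0∞ // δ ≠ 0}),
      ∃ (U : Set (EuclideanSpace ℝ (Fin n))) (δ' : {δ : ℝ≥0∞ // δ ≠ 0}), MeasurableSet U ∧
        (∀ x, HitsAtMostOnce (latticeTranslate Γ) U x) ∧ volume U ≤ δ / 2 ∧
        (δ' : ℝ≥0∞) ≤ δ / 2 ∧ ∀ Z, volume (U ∩ Z) ≤ δ' →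
          volume (Metric.ball 0 ((s : ℝ) + 1) \
            saturation (fun j : ℤ => dilation A j) (U \ Z)) ≤ ((s : ℝ≥0∞) + 1)⁻¹ := by
    rintro s ⟨δ, hδ⟩
    have hs0 : ((s : ℝ≥0∞) + 1)⁻¹ ≠ 0 := by simp
    have hst : ((s : ℝ≥0∞) + 1)⁻¹ ≠ ∞ := by simp
    have hδ2 : δ / 2 ≠ 0 := by simp [hδ]
    obtain ⟨U, hUm, hUp, hUv, hUc⟩ := exists_small_packing_covering Γ hA hdiv
      (R := (s : ℝ) + 1) (by positivity) (ε := min (δ / 2) (((s : ℝ≥0∞) + 1)⁻¹ / 2))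
      (by simp [hδ])
    obtain ⟨δ', hδ', hδ'Z⟩ := exists_delta_volume_diff_saturation_le hA0 hUm
      (hUc.trans (min_le_right _ _)) (ENNReal.half_lt_self hs0 hst)
    refine ⟨U, ⟨min δ' (δ / 2), by simp [hδ', hδ]⟩, hUm, hUp, hUv.trans (min_le_left _ _),
      min_le_right _ _, fun Z hZ => hδ'Z Z (hZ.trans (min_le_left _ _))⟩
  choose u v hum hup huv hvv huZ using hstep
  let δ : ℕ → {δ : ℝ≥0∞ // δ ≠ 0} := fun s =>
    Nat.rec (motive := fun _ => {δ : ℝ≥0∞ // δ ≠ 0}) ⟨1, one_ne_zero⟩ (fun s δ => v s δ) s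
  let U : ℕ → Set (EuclideanSpace ℝ (Fin n)) := fun s => u s (δ s)
  have hδ : ∀ s, δ (s + 1) = v s (δ s) := fun _ => rfl
  have hδhalf : ∀ s k, (δ (s + k) : ℝ≥0∞) ≤ (δ s : ℝ≥0∞) * 2⁻¹ ^ k := by
    intro s k
    induction k with
    | zero => simp
    | succ k ih =>
      rw [← add_assoc, hδ, pow_succ, ← mul_assoc]
      exact (hvv _ _).trans (by rw [div_eq_mul_inv]; gcongr)
  have hUvol : ∀ s k, volume (U (s + 1 + k)) ≤ (δ (s + 1) : ℝ≥0∞) / 2 * 2⁻¹ ^ k := fun s k => by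
    refine (huv _ _).trans ?_
    rw [div_eq_mul_inv, div_eq_mul_inv, mul_right_comm]
    exact mul_le_mul_left (hδhalf _ _) _
  -- All orbits used by later sets. Their total volume is within the loss `δ (s + 1)` that the
  -- coverage by `U s` tolerates.
  let T : ℕ → Set (EuclideanSpace ℝ (Fin n)) := fun s =>
    ⋃ k, saturation (latticeTranslate Γ) (U (s + 1 + k))
  have hTm : ∀ s, MeasurableSet (T s) := fun s =>
    MeasurableSet.iUnion fun k => (hum _ _).saturation (measurable_latticeTranslate Γ)
  have hUT : ∀ s, volume (U s ∩ T s) ≤ δ (s + 1) := by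
    intro s
    calc volume (U s ∩ T s)
        ≤ ∑' k, volume (U s ∩ saturation (latticeTranslate Γ) (U (s + 1 + k))) := by
          rw [Set.inter_iUnion]
          exact measure_iUnion_le _
      _ ≤ ∑' k, (δ (s + 1) : ℝ≥0∞) / 2 * 2⁻¹ ^ k := by
          refine ENNReal.tsum_le_tsum fun k => le_trans ?_ (hUvol s k)
          have h := volume_le_mul_of_subset_saturation Γ (M := 1)
            (F := U s ∩ saturation (latticeTranslate Γ) (U (s + 1 + k)))
            ((hum _ _).inter ((hum _ _).saturation (measurable_latticeTranslate Γ)))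
            Set.inter_subset_right (Filter.Eventually.of_forall fun x =>
              tsum_indicator_le_one_iff.2 ((hup s (δ s) x).mono Set.inter_subset_left))
          rwa [one_mul] at h
      _ = δ (s + 1) := by
          rw [ENNReal.tsum_mul_left, ENNReal.tsum_geometric, ENNReal.one_sub_inv_two, inv_inv,
            ENNReal.div_mul_cancel two_ne_zero ENNReal.ofNat_ne_top]
  refine ⟨⋃ s, U s \ T s, MeasurableSet.iUnion fun s => (hum _ _).diff (hTm s), ?_, ?_⟩
  · have hlt : ∀ x g h s t, s < t → latticeTranslate Γ g x ∈ U s \ T s →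
        latticeTranslate Γ h x ∉ U t := by
      intro x g h s t hst hg hh
      refine hg.2 (Set.mem_iUnion.2 ⟨t - (s + 1), h - g, ?_⟩)
      rw [← latticeTranslate_add, sub_add_cancel, show s + 1 + (t - (s + 1)) = t by lia]
      exact hh
    intro x g h hg hh
    obtain ⟨s, hs⟩ := Set.mem_iUnion.1 hg
    obtain ⟨t, ht⟩ := Set.mem_iUnion.1 hh
    rcases lt_trichotomy s t with hst | rfl | hst
    · exact absurd ht.1 (hlt x g h s t hst hs)
    · exact hup s (δ s) x g h hs.1 ht.1
    · exact absurd hs.1 (hlt x h g t s hst ht)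
  · set Cov := saturation (fun j : ℤ => dilation A j) (⋃ s, U s \ T s) with hCov
    have hball : ∀ r : ℕ, volume (Metric.ball 0 (r : ℝ) \ Cov) = 0 := by
      intro r
      refine le_antisymm (ENNReal.le_of_forall_pos_le_add fun ε hε _ => ?_) bot_le
      obtain ⟨m, hm⟩ := ENNReal.exists_inv_nat_lt (a := ε) (by exact_mod_cast hε.ne')
      rw [zero_add]
      -- Stage max r m controls a ball containing B(0,r), with error at most 1/m.
      refine le_trans (le_trans (measure_mono ?_) (huZ (max r m) (δ (max r m)) (T (max r m))
        (hUT _))) (le_trans ?_ hm.le)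
      · refine Set.sdiff_subset_sdiff (Metric.ball_subset_ball ?_)
          (saturation_mono (Set.subset_iUnion (fun s => U s \ T s) (max r m)))
        have : (r : ℝ) ≤ ((max r m : ℕ) : ℝ) := by exact_mod_cast le_max_left r m
        linarith
      · rw [ENNReal.inv_le_inv]
        have : (m : ℝ≥0∞) ≤ ((max r m : ℕ) : ℝ≥0∞) := by exact_mod_cast le_max_right r m
        exact this.trans le_self_add
    have : volume Covᶜ = 0 := by
      refine measure_mono_null (fun x hx => ?_) (measure_iUnion_null hball)
      obtain ⟨r, hr⟩ := exists_nat_gt ‖x‖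
      exact Set.mem_iUnion.2 ⟨r, by simpa using hr, hx⟩
    exact this

theorem exists_isWaveletSet (hA : 1 < |A.det|) {r : ℝ} (hr : 0 < r)
    (h : ∑' j : ℕ, (1 : ℝ≥0∞) / (latticeCount A Γ (-((j : ℤ) + 1)) r : ℝ≥0∞) = ∞) :
    ∃ W, IsWaveletSet A Γ W := by
  have hA0 : A.det ≠ 0 := abs_pos.1 (by linarith)
  obtain ⟨U, hUm, hUp, hUc⟩ := exists_packs_translations_covers_dilations Γ hA
    fun ρ => tsum_inv_latticeCount_eq_top Γ hA0 hr ρ h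
  obtain ⟨D, hDm, hDp, hDc⟩ := exists_dilation_fundamentalDomain hA
  obtain ⟨V, hVm, hVp, hVt⟩ := exists_tiles_translations_packs_dilations Γ hA
  have hdm : ∀ j : ℤ, Measurable (dilation A j) := measurable_dilation
  -- U only covers by dilations; a transversal subset tiles almost everywhere and still packs by
  -- translations.
  obtain ⟨U', hU'U, hU'm, hU'⟩ := exists_transversal_subset
    (a := fun j : ℤ => dilation A j) (dilation_add hA0) hdm hDm hUm
  obtain ⟨W, hWm, hWd, hWt⟩ := exists_common_tile
    (a := fun j : ℤ => dilation A j) (dilation_add hA0) (latticeTranslate_add Γ) hdm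
    (measurable_latticeTranslate Γ) hU'm hVm
  have hd : ∀ᵐ x, HitsAtMostOnce (fun j : ℤ => dilation A j) W x ∧
      x ∈ saturation (fun j : ℤ => dilation A j) W := by
    filter_upwards [hUc, hDc] with x hxU hxD
    obtain ⟨h1, h2⟩ := hU' x hxD (hDp x)
    exact hWd x h1 (h2 hxU) (hVp x)
  have ht : ∀ x, HitsAtMostOnce (latticeTranslate Γ) W x ∧
      x ∈ saturation (latticeTranslate Γ) W := fun x =>
    hWt x (hVt x).1 (hVt x).2 ((hUp x).mono hU'U)
  exact ⟨W, hWm.nullMeasurableSet,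
    hd.mono fun x hx => tsum_indicator_le_one_iff.2 hx.1,
    hd.mono fun x hx => one_le_tsum_indicator_iff.2 hx.2,
    Filter.Eventually.of_forall fun x => tsum_indicator_le_one_iff.2 (ht x).1,
    Filter.Eventually.of_forall fun x => one_le_tsum_indicator_iff.2 (ht x).2⟩

end Existence

/-! ### Divergence from the existence of a wavelet set -/

section Necessity

variable {n : ℕ} (Γ : Submodule ℤ (EuclideanSpace ℝ (Fin n))) {A : Matrix (Fin n) (Fin n) ℝ}

/-- The translates of the piece of W by the counted lattice points are disjoint up to null sets, and
the triangle inequality puts them all in the larger ellipsoid. -/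
theorem latticeCount_mul_volume_le [Countable Γ] (hA : A.det ≠ 0)
    {W : Set (EuclideanSpace ℝ (Fin n))} (hW : MeasurableSet W)
    (hWp : ∀ᵐ x, HitsAtMostOnce (latticeTranslate Γ) W x) (j : ℤ) (r r' : ℝ) :
    (latticeCount A Γ (-j) r : ℝ≥0∞) * volume (dilation A j ⁻¹' Metric.ball 0 r' ∩ W) ≤
      volume (dilation A j ⁻¹' Metric.ball 0 (r + r')) := by
  set G := dilation A j ⁻¹' Metric.ball 0 r' ∩ W with hG
  have hGm : MeasurableSet G :=
    (measurable_dilation j Metric.isOpen_ball.measurableSet).inter hW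
  set s : Set Γ := {γ | (γ : EuclideanSpace ℝ (Fin n)) ∈ dilation A j ⁻¹' Metric.ball 0 r} with hs
  set L := dilation A j ⁻¹' Metric.ball 0 (r + r') with hL
  have hLm : MeasurableSet L := measurable_dilation j Metric.isOpen_ball.measurableSet
  have hm : ∀ γ : Γ, MeasurableSet (latticeTranslate Γ (-γ) ⁻¹' G) := fun γ =>
    measurable_latticeTranslate Γ _ hGm
  calc (latticeCount A Γ (-j) r : ℝ≥0∞) * volume G = ∑' _ : s, volume G := by
        rw [ENNReal.tsum_const, latticeCount_eq hA, neg_neg]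
        rfl
    _ = ∑' γ : s, ∫⁻ x, (latticeTranslate Γ (-(γ : Γ)) ⁻¹' G).indicator 1 x := by
        refine tsum_congr fun γ => ?_
        rw [lintegral_indicator_one (hm γ), volume_preimage_latticeTranslate]
    _ = ∫⁻ x, ∑' γ : s, (latticeTranslate Γ (-(γ : Γ)) ⁻¹' G).indicator 1 x :=
        (lintegral_tsum fun γ : s => (measurable_one.indicator (hm γ)).aemeasurable).symm
    _ ≤ ∫⁻ x, L.indicator 1 x := by
        refine lintegral_mono_ae ?_
        filter_upwards [hWp] with x hx
        by_cases hxL : x ∈ L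
        · rw [Set.indicator_of_mem hxL, Pi.one_apply]
          refine (tsum_indicator_le_one_iff (a := fun (γ : s) => latticeTranslate Γ (-(γ : Γ)))
            (S := G) (x := x)).2 fun g h hg hh => ?_
          exact Subtype.ext (neg_injective (hx _ _ hg.2 hh.2))
        · refine le_of_eq_of_le (ENNReal.tsum_eq_zero.2 fun γ => ?_) bot_le
          refine Set.indicator_of_notMem (fun hγ => hxL ?_) _
          have h1 : ‖dilation A j (latticeTranslate Γ (-(γ : Γ)) x)‖ < r' := by simpa using hγ.1
          have h2 : ‖dilation A j ((γ : Γ) : EuclideanSpace ℝ (Fin n))‖ < r := by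
            simpa [hs] using γ.2
          have h3 : dilation A j x = dilation A j ((γ : Γ) : EuclideanSpace ℝ (Fin n)) +
              dilation A j (latticeTranslate Γ (-(γ : Γ)) x) := by
            rw [← map_add]
            simp [latticeTranslate]
          rw [hL, Set.mem_preimage, mem_ball_zero_iff, h3]
          linarith [norm_add_le (dilation A j ((γ : Γ) : EuclideanSpace ℝ (Fin n)))
            (dilation A j (latticeTranslate Γ (-(γ : Γ)) x))]
    _ = volume L := lintegral_indicator_one hLm

theorem tsum_inv_latticeCount_eq_top_of_isWaveletSet [DiscreteTopology Γ] [IsZLattice ℝ Γ]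
    (hA : 1 < |A.det|) {W : Set (EuclideanSpace ℝ (Fin n))} (hW : IsWaveletSet A Γ W) :
    ∑' j : ℕ, (latticeCount A Γ (-((j : ℤ) + 1)) 1 : ℝ≥0∞)⁻¹ = ∞ := by
  have hA0 : A.det ≠ 0 := abs_pos.1 (by linarith)
  have hn : n ≠ 0 := by
    rintro rfl
    simp at hA
  have : Nonempty (Fin n) := ⟨⟨0, Nat.pos_of_ne_zero hn⟩⟩
  have : Nontrivial (EuclideanSpace ℝ (Fin n)) := inferInstance
  by_contra hsum
  set d := |A.det| with hd
  have hd0 : 0 < d := by linarith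
  -- W is only null measurable; a Borel subset of full measure still packs.
  obtain ⟨W₀, hW₀W, hW₀m, hW₀⟩ := hW.measurable.exists_measurable_subset_ae_eq
  have hW₀p : ∀ᵐ x, HitsAtMostOnce (latticeTranslate Γ) W₀ x :=
    hW.packs_translations.mono fun x hx =>
      ((tsum_indicator_le_one_iff (a := latticeTranslate Γ)).1 hx).mono hW₀W
  have hWv : volume W ≠ ∞ := by
    obtain ⟨D, hDm, hDb, hD⟩ := exists_lattice_fundamentalDomain Γ
    rw [← measure_congr hW₀]
    have h := volume_le_mul_of_subset_saturation Γ (M := 1) hW₀m (fun x _ => (hD x).2)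
      (hW₀p.mono fun x hx => tsum_indicator_le_one_iff.2 hx)
    rw [one_mul] at h
    exact (h.trans_lt hDb.measure_lt_top).ne
  set b : ℝ≥0∞ := volume (Metric.ball (0 : EuclideanSpace ℝ (Fin n)) 1) with hb
  have hb0 : b ≠ 0 := (Metric.measure_ball_pos volume _ one_pos).ne'
  have hbt : b ≠ ∞ := measure_ball_lt_top.ne
  have hball : ∀ R : ℝ, 0 ≤ R →
      volume (Metric.ball (0 : EuclideanSpace ℝ (Fin n)) R) = ENNReal.ofReal (R ^ n) * b := by
    intro R hR
    rw [Measure.addHaar_ball volume _ hR, finrank_euclideanSpace_fin]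
  set N : ℕ → ℝ≥0∞ := fun k => (latticeCount A Γ (-((k : ℤ) + 1)) 1 : ℝ≥0∞)⁻¹ with hN
  have htail := ENNReal.tendsto_sum_nat_add N hsum
  -- The factor 2ⁿ bounds |B(0,1+R)| / |B(0,R)| for R ≥ 1, so scales beyond J cover at most half of
  -- the ball.
  obtain ⟨J, hJ⟩ := (htail.eventually_lt_const
    (u := 2⁻¹ / 2 ^ n) (ENNReal.div_pos (by simp) (by simp))).exists
  have hq : ENNReal.ofReal d⁻¹ < 1 := by
    rw [ENNReal.ofReal_lt_one]
    exact inv_lt_one_of_one_lt₀ hA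
  -- Bound for all remaining scales: a geometric series in d⁻¹ and finitely many expanding terms,
  -- none depending on R.
  set C : ℝ≥0∞ := (∑' k : ℕ, ENNReal.ofReal d⁻¹ ^ k * volume W) +
    ∑ k ∈ Finset.range J, ENNReal.ofReal (d ^ (k + 1)) * volume W with hC
  have hCt : C ≠ ∞ := by
    refine ENNReal.add_ne_top.2 ⟨?_, ENNReal.sum_ne_top.2 fun k _ =>
      ENNReal.mul_ne_top ENNReal.ofReal_ne_top hWv⟩
    rw [ENNReal.tsum_mul_right, ENNReal.tsum_geometric]
    exact ENNReal.mul_ne_top (ENNReal.inv_ne_top.2 (tsub_pos_of_lt hq).ne') hWv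
  have main : ∀ R : ℝ, 1 ≤ R → volume (Metric.ball (0 : EuclideanSpace ℝ (Fin n)) R) / 2 ≤ C := by
    intro R hR
    set B : Set (EuclideanSpace ℝ (Fin n)) := Metric.ball 0 R with hB
    let f : ℤ → ℝ≥0∞ := fun j => volume (B ∩ dilation A j ⁻¹' W)
    have hf : ∀ j, f j = ENNReal.ofReal (d⁻¹ ^ j) * volume (dilation A (-j) ⁻¹' B ∩ W) := by
      intro j
      have : B ∩ dilation A j ⁻¹' W = dilation A j ⁻¹' (dilation A (-j) ⁻¹' B ∩ W) := by
        ext x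
        simp [dilation_neg_dilation hA0]
      rw [← volume_preimage_dilation hA0, ← this]
    have hcover : volume B ≤ ∑' j, f j := by
      refine le_trans (measure_mono_ae ?_) (measure_iUnion_le _)
      filter_upwards [hW.covers_dilations] with x hx hxB
      obtain ⟨j, hj⟩ := (one_le_tsum_indicator_iff (a := fun j : ℤ => dilation A j)).1 hx
      exact Set.mem_iUnion.2 ⟨j, hxB, hj⟩
    have hsplit : ∑' j, f j = ∑' k : ℕ, f k + ∑' k : ℕ, f (-((k : ℤ) + 1)) :=
      (HasSum.of_nat_of_neg_add_one (ENNReal.summable.hasSum) (ENNReal.summable.hasSum)).tsum_eq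
    have hneg : ∀ k : ℕ, f (-((k : ℤ) + 1)) =
        ENNReal.ofReal (d ^ (k + 1)) * volume (dilation A ((k : ℤ) + 1) ⁻¹' B ∩ W) := by
      intro k
      rw [hf, neg_neg, inv_zpow', neg_neg]
      norm_cast
    have h1 : ∀ k : ℕ, f k ≤ ENNReal.ofReal d⁻¹ ^ k * volume W := by
      intro k
      rw [hf, zpow_natCast, ENNReal.ofReal_pow (by positivity)]
      gcongr
      exact Set.inter_subset_right
    have h2 : ∀ k : ℕ, f (-((k : ℤ) + 1)) ≤ ENNReal.ofReal (d ^ (k + 1)) * volume W := by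
      intro k
      rw [hneg]
      gcongr
      exact Set.inter_subset_right
    -- The Jacobian d^(k+1) cancels the volume factor of the ellipsoid, leaving only the inverse
    -- count `N k`.
    have h3 : ∀ k : ℕ, f (-((k : ℤ) + 1)) ≤ N k * (2 ^ n * volume B) := by
      intro k
      have hpos := ENat.toENNReal_le.2 (one_le_latticeCount Γ hA0 (-((k : ℤ) + 1)) one_pos)
      rw [ENat.toENNReal_one] at hpos
      have hle := latticeCount_mul_volume_le Γ hA0 hW₀m hW₀p ((k : ℤ) + 1) 1 R
      have hvol : volume (dilation A ((k : ℤ) + 1) ⁻¹' Metric.ball 0 (1 + R)) ≤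
          ENNReal.ofReal ((d ^ (k + 1))⁻¹) * (2 ^ n * volume B) := by
        rw [volume_preimage_dilation hA0, ← hd, inv_zpow]
        have e1 : d ^ ((k : ℤ) + 1) = d ^ (k + 1) := by norm_cast
        rw [e1]
        gcongr
        calc volume (Metric.ball (0 : EuclideanSpace ℝ (Fin n)) (1 + R))
            ≤ volume (Metric.ball (0 : EuclideanSpace ℝ (Fin n)) (2 * R)) :=
              measure_mono (Metric.ball_subset_ball (by linarith))
          _ = 2 ^ n * volume B := by
              rw [hB, hball _ (by linarith), hball _ (by linarith), mul_pow,
                ENNReal.ofReal_mul (by positivity), mul_assoc, ENNReal.ofReal_pow (by positivity)]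
              simp
      have e2 : volume (dilation A ((k : ℤ) + 1) ⁻¹' B ∩ W) =
          volume (dilation A ((k : ℤ) + 1) ⁻¹' B ∩ W₀) :=
        measure_congr (Filter.EventuallyEq.inter (Filter.EventuallyEq.refl _ _) hW₀.symm)
      have h4 : volume (dilation A ((k : ℤ) + 1) ⁻¹' B ∩ W) ≤
          ENNReal.ofReal ((d ^ (k + 1))⁻¹) * (2 ^ n * volume B) * N k := by
        rw [e2, hN, ← div_eq_mul_inv, ENNReal.le_div_iff_mul_le
          (Or.inl (zero_lt_one.trans_le hpos).ne')
          (Or.inr (ENNReal.mul_ne_top ENNReal.ofReal_ne_top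
            (ENNReal.mul_ne_top (by simp) measure_ball_lt_top.ne))), mul_comm]
        exact hle.trans hvol
      calc f (-((k : ℤ) + 1)) ≤ ENNReal.ofReal (d ^ (k + 1)) *
            (ENNReal.ofReal ((d ^ (k + 1))⁻¹) * (2 ^ n * volume B) * N k) := by
            rw [hneg]; gcongr
        _ = (ENNReal.ofReal (d ^ (k + 1)) * ENNReal.ofReal ((d ^ (k + 1))⁻¹)) *
            (N k * (2 ^ n * volume B)) := by ring
        _ = N k * (2 ^ n * volume B) := by
            rw [← ENNReal.ofReal_mul (by positivity), mul_inv_cancel₀ (by positivity),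
              ENNReal.ofReal_one, one_mul]
    have h5 : ∑' k : ℕ, f (-((k : ℤ) + 1)) ≤
        ∑ k ∈ Finset.range J, ENNReal.ofReal (d ^ (k + 1)) * volume W + volume B / 2 := by
      rw [← (ENNReal.summable (f := fun k : ℕ =>
        f (-(((k + J : ℕ) : ℤ) + 1)))).sum_add_tsum_nat_add' (f := fun k : ℕ => f (-((k : ℤ) + 1)))]
      refine add_le_add (Finset.sum_le_sum fun k _ => h2 k) ?_
      calc ∑' k : ℕ, f (-(((k + J : ℕ) : ℤ) + 1)) ≤ ∑' k : ℕ, N (k + J) * (2 ^ n * volume B) :=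
            ENNReal.tsum_le_tsum fun k => h3 (k + J)
        _ = (∑' k : ℕ, N (k + J)) * (2 ^ n * volume B) := ENNReal.tsum_mul_right
        _ ≤ 2⁻¹ / 2 ^ n * (2 ^ n * volume B) := by gcongr
        _ = volume B / 2 := by
            rw [← mul_assoc, ENNReal.div_mul_cancel (by simp) (by simp), mul_comm, div_eq_mul_inv]
    have h6 : volume B / 2 + volume B / 2 ≤ C + volume B / 2 := by
      rw [ENNReal.add_halves, hC, add_assoc]
      refine hcover.trans (hsplit.le.trans (add_le_add (ENNReal.tsum_le_tsum h1) h5))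
    exact (ENNReal.add_le_add_iff_right
      (ENNReal.div_ne_top measure_ball_lt_top.ne two_ne_zero)).1 h6
  set R : ℝ := (C * 2 / b).toReal + 1 with hR
  have hR1 : 1 ≤ R := by
    have : 0 ≤ (C * 2 / b).toReal := ENNReal.toReal_nonneg
    linarith
  have h := main R hR1
  have hCb : C * 2 / b ≠ ∞ := ENNReal.div_ne_top (ENNReal.mul_ne_top hCt (by simp)) hb0
  rw [ENNReal.div_le_iff two_ne_zero (by simp), hball R (by linarith),
    ← ENNReal.le_div_iff_mul_le (Or.inl hb0) (Or.inl hbt)] at h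
  have h7 : ENNReal.ofReal R ≤ C * 2 / b :=
    (ENNReal.ofReal_le_ofReal (le_self_pow₀ hR1 hn)).trans h
  rw [ENNReal.ofReal_le_iff_le_toReal hCb] at h7
  linarith

end Necessity

/-! ### Inverting the matrix and conclusion -/

theorem isWaveletSet_of_inv {n : ℕ} {A : Matrix (Fin n) (Fin n) ℝ} (hA : A.det ≠ 0)
    {Γ : Submodule ℤ (EuclideanSpace ℝ (Fin n))} {W : Set (EuclideanSpace ℝ (Fin n))}
    (hW : IsWaveletSet A⁻¹ Γ W) : IsWaveletSet A Γ W := by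
  have key : ∀ x, ∑' j : ℤ, W.indicator (fun _ => (1 : ℝ≥0∞)) (dilation A⁻¹ j x) =
      ∑' j : ℤ, W.indicator (fun _ => (1 : ℝ≥0∞)) (dilation A j x) := by
    intro x
    simp_rw [dilation_inv hA]
    exact (Equiv.neg ℤ).tsum_eq fun j => W.indicator (fun _ => (1 : ℝ≥0∞)) (dilation A j x)
  exact ⟨hW.measurable, hW.packs_dilations.mono fun x hx => key x ▸ hx,
    hW.covers_dilations.mono fun x hx => key x ▸ hx, hW.packs_translations,
    hW.covers_translations⟩

theorem theorem1p2 {n : ℕ} (A : Matrix (Fin n) (Fin n) ℝ)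
    (Γ : Submodule ℤ (EuclideanSpace ℝ (Fin n))) [DiscreteTopology Γ] [IsZLattice ℝ Γ] :
    (1 < |A.det| →
      ((∃ W, IsWaveletSet A Γ W) ↔
        ∑' j : ℕ, (1 : ℝ≥0∞) / (latticeCount A Γ (-((j : ℤ) + 1)) 1 : ℝ≥0∞) = ∞)) ∧
    (∀ r : ℝ, 0 < r →
      (1 < |A.det| →
        ∑' j : ℕ, (1 : ℝ≥0∞) / (latticeCount A Γ (-((j : ℤ) + 1)) r : ℝ≥0∞) = ∞ →
          ∃ W, IsWaveletSet A Γ W) ∧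
      (A.det ≠ 0 → |A.det| < 1 →
        ∑' j : ℕ, (1 : ℝ≥0∞) / (latticeCount A Γ ((j : ℤ) + 1) r : ℝ≥0∞) = ∞ →
          ∃ W, IsWaveletSet A Γ W)) := by
  refine ⟨fun hA => ⟨fun ⟨W, hW⟩ => ?_, exists_isWaveletSet Γ hA one_pos⟩,
    fun r hr => ⟨fun hA => exists_isWaveletSet Γ hA hr, fun hA0 hA h => ?_⟩⟩
  · simp_rw [one_div]
    exact tsum_inv_latticeCount_eq_top_of_isWaveletSet Γ hA hW
  · have hdet : 1 < |A⁻¹.det| := by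
      rw [Matrix.det_nonsing_inv, Ring.inverse_eq_inv', abs_inv]
      exact (one_lt_inv₀ (abs_pos.2 hA0)).2 hA
    have hcount : ∀ j : ℤ, latticeCount A⁻¹ Γ (-j) r = latticeCount A Γ j r := fun j => by
      rw [latticeCount, dilation_inv hA0, neg_neg, latticeCount]
    obtain ⟨W, hW⟩ := exists_isWaveletSet Γ hdet hr (by simpa only [hcount] using h)
    exact ⟨W, isWaveletSet_of_inv hA0 hW⟩
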